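/- Let $d\ge 0$ and, for each direction $k=1,\dots,d$, let $p_k\ge 0$ be a degree, $n_k$ a dimension, and $\Xi_k=(\xi_{k,1}\le\dots\le\xi_{k,n_k+p_k+1})$ a non-decreasing knot vector with $\xi_{k,p_k+1}=0$ and $\xi_{k,n_k+1}=1$ (for example an open knot vector on $[0,1]$). Let $\hat B_{k,1},\dots,\hat B_{k,n_k}$ be the B-splines of degree $p_k$ on $\Xi_k$ given by the Cox–de Boor recursion (with the convention $\cdot/0=0$), starting from the indicator functions of the half-open knot spans, with the left limit taken at the right end point $1$. For a multi-index $i=(i_1,\dots,i_d)$ with $1\le i_k\le n_k$ put $\hat B_i(\hat x)=\prod_{k=1}^d\hat B_{k,i_k}(\hat x_k)$ for $\hat x\in[0,1]^d$. Let the single-patch geometry map $F:[0,1]^d\to\mathbb R^d$ be injective, and let $B_i=\hat B_i\circ F^{-1}$ on $F([0,1]^d)$. Let $\hat x_{k,1},\dots,\hat x_{k,n_k}\in[0,1]$ be given in each direction, and assume that the tensor-product interpolation points $x_i=F(\hat x_{1,i_1},\dots,\hat x_{d,i_d})$ are pairwise distinct. Let $A$ be the collocation matrix $A_{ij}=B_j(x_i)$,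 with rows and columns indexed by the multi-indices. Then: 1. If $B_i(x_i)>0$ for every $i$, then $A$ is invertible. 2. If the points are numbered in increasing order in each direction, i.e. $\hat x_{k,1}\le\dots\le\hat x_{k,n_k}$ for every $k$, then $A$ is invertible if and only if $B_i(x_i)>0$ for every $i$. -/

import Mathlib

noncomputable section

namespace TensorSpline

/-- A knot vector of degree `p` for an `n`-dimensional univariate spline space on the parametric
interval `[0, 1]`: a non-decreasing sequence of `n + p + 1` real numbers (numbered from `0`), whose
`p`-th and `n`-th entries are the end points of the parametric interval. Every clamped (open) knot
vector is of this kind, with its first `p + 1` knots equal to `0` and its last `p + 1` equal to `1`.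
The inequality `p + 1 ≤ n` follows from the fields. -/
structure KnotVector (p n : ℕ) where
  /-- the knots -/
  knot : Fin (n + p + 1) → ℝ
  monotone_knot : Monotone knot
  knot_left : knot ⟨p, by omega⟩ = 0
  knot_right : knot ⟨n, by omega⟩ = 1

/-- The knots as a sequence on `ℕ`; the values beyond the last knot (all equal to the last knot)
never enter the B-splines with index below `n`. -/
def KnotVector.seq {p n : ℕ} (Ξ : KnotVector p n) (m : ℕ) : ℝ :=
  Ξ.knot ⟨min m (n + p), by omega⟩

/-- The Cox--de Boor recursion on `[0, 1]`: `coxDeBoor t q i x` is the value at `x` of the `i`-th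
B-spline of degree `q` on the knots `t`. Quotients with denominator `0` count as `0`, as is usual
(and as in Lean). The degree zero functions are the indicator functions of the half-open knot spans
`[t i, t (i + 1))`, except at the right end point `1` of the interval, where the left limit is
taken, so that the B-splines are continuous from the left there. -/
def coxDeBoor (t : ℕ → ℝ) : ℕ → ℕ → ℝ → ℝ
  | 0, i, x =>
      open Classical in
      if (x ≠ 1 ∧ t i ≤ x ∧ x < t (i + 1)) ∨ (x = 1 ∧ t i < x ∧ x ≤ t (i + 1)) then 1 else 0
  | q + 1, i, x =>
      (x - t i) / (t (i + q + 1) - t i) * coxDeBoor t q i x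
        + (t (i + q + 2) - x) / (t (i + q + 2) - t (i + 1)) * coxDeBoor t q (i + 1) x

/-- The univariate B-spline with index `j` on the knot vector `Ξ`. -/
def KnotVector.bspline {p n : ℕ} (Ξ : KnotVector p n) (j : Fin n) (x : ℝ) : ℝ :=
  coxDeBoor Ξ.seq p j x

variable {d : ℕ} {p n : Fin d → ℕ}

/-- The tensor-product B-spline with multi-index `i` on the parametric domain `[0, 1]^d`. -/
def paramBasis (Ξ : ∀ k, KnotVector (p k) (n k)) (i : ∀ k, Fin (n k)) (u : Fin d → ℝ) : ℝ :=
  ∏ k, (Ξ k).bspline (i k) (u k)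

/-- The basis function `B_i ∘ F⁻¹` on the physical domain `F([0, 1]^d)`, where `F⁻¹` is the inverse
of the restriction of the geometry map `F` to `[0, 1]^d`. -/
def physBasis (Ξ : ∀ k, KnotVector (p k) (n k)) (F : (Fin d → ℝ) → (Fin d → ℝ))
    (i : ∀ k, Fin (n k)) (y : Fin d → ℝ) : ℝ :=
  paramBasis Ξ i (Function.invFunOn F (Set.Icc 0 1) y)

/-- The interpolation point with multi-index `i` on the physical domain: the image under `F` of the
point of the tensor-product grid with coordinates `ξ k (i k)`. -/
def interpPoint (F : (Fin d → ℝ) → (Fin d → ℝ)) (ξ : ∀ k, Fin (n k) → ℝ)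
    (i : ∀ k, Fin (n k)) : Fin d → ℝ :=
  F (fun k => ξ k (i k))

/-- The collocation matrix with entries `B_j(x_i)`, for arbitrary functions and points. -/
def collocationMatrix {ι X : Type*} (B : ι → X → ℝ) (x : ι → X) : Matrix ι ι ℝ :=
  Matrix.of fun i j => B j (x i)

end TensorSpline

end

/-!
Up to a tensor product and a permutation of the points, `A` is the collocation matrix of univariate
B-splines at increasing points, so the theorem reduces to the Schoenberg–Whitney theorem.

If this matrix is invertible, some product of entries along a permutation does not vanish, and since
the supports of the B-splines move to the right with the index, the diagonal entries do not vanish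
either. For the converse, insert a knot. By Boehm's formula every B-spline is a combination with
non-negative coefficients of two neighbouring B-splines on the refined knots, so the determinant is
a combination with non-negative coefficients of such determinants for the refined knots, one of
which has a positive diagonal if the original one has. After finitely many insertions each point is
a knot of full multiplicity. Then only one B-spline is positive at each point, and a determinant
with positive diagonal is that of a diagonal matrix.
-/

namespace TensorSpline

section Support

/-- The knot `τ` is passed before the evaluation point `x`. As the B-splines are continuous from the
right, except at `1`, where the left limit is taken, `x` stands for a point infinitesimally to the
right of `x` if `x ≠ 1`, and infinitesimally to the left of it if `x = 1`. -/
def LeftOf (τ x : ℝ) : Prop := τ < x ∨ (τ = x ∧ x ≠ 1)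

/-- The condition at the left end of the support under which the B-spline of degree `q` with index
`i` is positive at `x`. -/
def StartsBefore (t : ℕ → ℝ) (q i : ℕ) (x : ℝ) : Prop :=
  LeftOf (t i) x ∧ (t i < x ∨ LeftOf (t (i + q)) x)

/-- The condition at the right end of the support under which the B-spline of degree `q` with index
`i` is positive at `x`. -/
def EndsAfter (t : ℕ → ℝ) (q i : ℕ) (x : ℝ) : Prop :=
  ¬ LeftOf (t (i + q + 1)) x ∧ (x < t (i + q + 1) ∨ ¬ LeftOf (t (i + 1)) x)

/-- The set of positivity of a B-spline: the open interval between its first and its last knot,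
together with an end point at which the B-spline jumps and `x` is approached from inside. -/
def InSupport (t : ℕ → ℝ) (q i : ℕ) (x : ℝ) : Prop :=
  StartsBefore t q i x ∧ EndsAfter t q i x

variable {t u : ℕ → ℝ} {q i j : ℕ} {x y τ σ : ℝ}

theorem LeftOf.le (h : LeftOf τ x) : τ ≤ x :=
  h.elim le_of_lt fun h => h.1.le

theorem le_of_not_leftOf (h : ¬ LeftOf τ x) : x ≤ τ :=
  le_of_not_gt fun hlt => h (Or.inl hlt)

theorem LeftOf.mono (h : LeftOf τ x) (hστ : σ ≤ τ) (hxy : x ≤ y) : LeftOf σ y := by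
  grind [LeftOf]

theorem StartsBefore.mono (ht : Monotone t) (h : StartsBefore t q i x) (hji : j ≤ i)
    (hxy : x ≤ y) : StartsBefore t q j y :=
  ⟨h.1.mono (ht hji) hxy, h.2.imp (fun hlt => (ht hji).trans_lt (hlt.trans_le hxy))
    fun hleft => hleft.mono (ht (by omega)) hxy⟩

theorem EndsAfter.mono (ht : Monotone t) (h : EndsAfter t q i x) (hij : i ≤ j)
    (hyx : y ≤ x) : EndsAfter t q j y :=
  ⟨fun hleft => h.1 (hleft.mono (ht (by omega)) hyx),
    h.2.imp (fun hlt => (hyx.trans_lt hlt).trans_le (ht (by omega)))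
      fun hnot hleft => hnot (hleft.mono (ht (by omega)) hyx)⟩

theorem InSupport.knot_le (h : InSupport t q i x) : t i ≤ x := h.1.1.le

theorem InSupport.le_knot (h : InSupport t q i x) : x ≤ t (i + q + 1) := le_of_not_leftOf h.2.1

theorem InSupport.knot_lt_knot (h : InSupport t q i x) : t i < t (i + q + 1) :=
  lt_of_not_ge fun hle => h.2.1 (h.1.1.mono hle le_rfl)

theorem inSupport_congr (hlt : ∀ k, t (i + k) < x ↔ u (j + k) < x)
    (hgt : ∀ k, x < t (i + k) ↔ x < u (j + k)) : InSupport t q i x ↔ InSupport u q j x := by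
  have hleft (k : ℕ) : LeftOf (t (i + k)) x ↔ LeftOf (u (j + k)) x := by
    grind [LeftOf]
  simp only [InSupport, StartsBefore, EndsAfter, add_assoc, hleft, hgt,
    show t i < x ↔ u j < x from hlt 0, show LeftOf (t i) x ↔ LeftOf (u j) x from hleft 0]

theorem inSupport_zero_iff : InSupport t 0 i x ↔
    (x ≠ 1 ∧ t i ≤ x ∧ x < t (i + 1)) ∨ (x = 1 ∧ t i < x ∧ x ≤ t (i + 1)) := by
  grind [InSupport, StartsBefore, EndsAfter, LeftOf]

theorem inSupport_succ_iff (ht : Monotone t) : InSupport t (q + 1) i x ↔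
    (t i < x ∧ InSupport t q i x) ∨ (x < t (i + q + 2) ∧ InSupport t q (i + 1) x) := by
  have e : i + 1 + q = i + q + 1 := by omega
  simp only [InSupport, StartsBefore, EndsAfter, ← add_assoc, e]
  have first : t i ≤ t (i + 1) := ht (by omega)
  have middle : t (i + 1) ≤ t (i + q + 1) := ht (by omega)
  have last : t (i + q + 1) ≤ t (i + q + 2) := ht (by omega)
  grind [LeftOf]

end Support

section Positivity

variable {t u : ℕ → ℝ} {q i : ℕ} {x : ℝ}

theorem coxDeBoor_congr (h : ∀ k ≤ i + q + 1, t k = u k) :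
    coxDeBoor t q i x = coxDeBoor u q i x := by
  induction q generalizing i with
  | zero => simp only [coxDeBoor, h i (by omega), h (i + 1) (by omega)]
  | succ q ih =>
    simp only [coxDeBoor, h i (by omega), h (i + 1) (by omega), h (i + q + 1) (by omega),
      h (i + q + 2) (by omega), ih (i := i) fun k hk => h k (by omega),
      ih (i := i + 1) fun k hk => h k (by omega)]

theorem coxDeBoor_eq_zero (ht : Monotone t) (h : ¬ InSupport t q i x) :
    coxDeBoor t q i x = 0 := by
  induction q generalizing i with
  | zero => rw [coxDeBoor, if_neg (mt inSupport_zero_iff.2 h)]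
  | succ q ih =>
    rw [inSupport_succ_iff ht, not_or] at h
    have left : (x - t i) / (t (i + q + 1) - t i) * coxDeBoor t q i x = 0 := by
      by_cases hi : InSupport t q i x
      · have hx : t i = x := hi.knot_le.eq_of_not_lt fun hlt => h.1 ⟨hlt, hi⟩
        rw [hx, sub_self, zero_div, zero_mul]
      · rw [ih hi, mul_zero]
    have right : (t (i + q + 2) - x) / (t (i + q + 2) - t (i + 1)) *
        coxDeBoor t q (i + 1) x = 0 := by
      by_cases hi : InSupport t q (i + 1) x
      · have hle := hi.le_knot
        rw [show i + 1 + q + 1 = i + q + 2 by omega] at hle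
        have hx : x = t (i + q + 2) := hle.eq_of_not_lt fun hlt => h.2 ⟨hlt, hi⟩
        rw [← hx, sub_self, zero_div, zero_mul]
      · rw [ih hi, mul_zero]
    rw [coxDeBoor, left, right, add_zero]

theorem coxDeBoor_pos (ht : Monotone t) (h : InSupport t q i x) : 0 < coxDeBoor t q i x := by
  induction q generalizing i with
  | zero =>
    rw [coxDeBoor, if_pos (inSupport_zero_iff.1 h)]
    exact one_pos
  | succ q ih =>
    have nonneg (j : ℕ) : 0 ≤ coxDeBoor t q j x := by
      by_cases hj : InSupport t q j x
      · exact (ih hj).le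
      · exact (coxDeBoor_eq_zero ht hj).ge
    have e : i + 1 + q + 1 = i + q + 2 := by omega
    have left : 0 ≤ (x - t i) / (t (i + q + 1) - t i) * coxDeBoor t q i x := by
      by_cases hi : InSupport t q i x
      · exact mul_nonneg (div_nonneg (sub_nonneg.2 hi.knot_le) (sub_nonneg.2 hi.knot_lt_knot.le))
          (nonneg i)
      · rw [coxDeBoor_eq_zero ht hi, mul_zero]
    have right : 0 ≤ (t (i + q + 2) - x) / (t (i + q + 2) - t (i + 1)) *
        coxDeBoor t q (i + 1) x := by
      by_cases hi : InSupport t q (i + 1) x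
      · rw [← e]
        exact mul_nonneg (div_nonneg (sub_nonneg.2 hi.le_knot) (sub_nonneg.2 hi.knot_lt_knot.le))
          (nonneg (i + 1))
      · rw [coxDeBoor_eq_zero ht hi, mul_zero]
    rw [coxDeBoor]
    rcases (inSupport_succ_iff ht).1 h with ⟨hlt, hi⟩ | ⟨hlt, hi⟩
    · exact add_pos_of_pos_of_nonneg
        (mul_pos (div_pos (sub_pos.2 hlt) (sub_pos.2 hi.knot_lt_knot)) (ih hi)) right
    · have hknot := hi.knot_lt_knot
      rw [e] at hknot
      exact add_pos_of_nonneg_of_pos left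
        (mul_pos (div_pos (sub_pos.2 hlt) (sub_pos.2 hknot)) (ih hi))

theorem coxDeBoor_ne_zero_iff (ht : Monotone t) : coxDeBoor t q i x ≠ 0 ↔ InSupport t q i x :=
  ⟨not_imp_comm.1 (coxDeBoor_eq_zero ht), fun h => (coxDeBoor_pos ht h).ne'⟩

theorem coxDeBoor_pos_iff (ht : Monotone t) : 0 < coxDeBoor t q i x ↔ InSupport t q i x :=
  ⟨fun h => (coxDeBoor_ne_zero_iff ht).1 h.ne', coxDeBoor_pos ht⟩

theorem coxDeBoor_nonneg (ht : Monotone t) : 0 ≤ coxDeBoor t q i x := by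
  by_cases h : InSupport t q i x
  · exact (coxDeBoor_pos ht h).le
  · exact (coxDeBoor_eq_zero ht h).ge

theorem coxDeBoor_eq_zero_of_knot_le (ht : Monotone t) (h : t (i + q + 1) ≤ t i) :
    coxDeBoor t q i x = 0 :=
  coxDeBoor_eq_zero ht fun hx => hx.knot_lt_knot.not_ge h

end Positivity

section KnotInsertion

/-- The affine function which is `0` at the knot `t i` and `1` at the knot `t (i + q)`, and `0` if
these knots coincide. -/
noncomputable def knotRatio (t : ℕ → ℝ) (q i : ℕ) (x : ℝ) : ℝ := (x - t i) / (t (i + q) - t i)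

/-- The knots `t` with a further knot `z` inserted after the one with index `m`. -/
def insertKnot (t : ℕ → ℝ) (m : ℕ) (z : ℝ) (k : ℕ) : ℝ :=
  if k ≤ m then t k else if k = m + 1 then z else t (k - 1)

/-- The coefficients in Boehm's formula, which expresses the B-splines on the knots `t` by those on
the refined knots `insertKnot t m z`. -/
noncomputable def insertCoeff (t : ℕ → ℝ) (m : ℕ) (z : ℝ) (q i : ℕ) : ℝ :=
  if i + q ≤ m then 1 else if i ≤ m then knotRatio t q i z else 0

variable {t : ℕ → ℝ} {m q i j k : ℕ} {x z : ℝ}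

/-- The second summand is `0` on both sides if the knots `t (i + 1)` and `t (i + q + 2)` coincide,
although the factor `1 - knotRatio t (q + 1) (i + 1) x` is then `1` instead of `0`. -/
theorem coxDeBoor_succ_eq_knotRatio (ht : Monotone t) : coxDeBoor t (q + 1) i x =
    knotRatio t (q + 1) i x * coxDeBoor t q i x +
      (1 - knotRatio t (q + 1) (i + 1) x) * coxDeBoor t q (i + 1) x := by
  have e : i + 1 + (q + 1) = i + q + 2 := by omega
  rw [coxDeBoor, knotRatio, knotRatio, e, ← add_assoc]
  congr 1
  rcases (ht (show i + 1 ≤ i + q + 2 by omega)).eq_or_lt with heq | hlt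
  · rw [coxDeBoor_eq_zero_of_knot_le ht (i := i + 1) (by rw [add_assoc, e, heq]), mul_zero,
      mul_zero]
  · rw [one_sub_div (sub_pos.2 hlt).ne', sub_sub_sub_cancel_right]

theorem insertKnot_of_le (h : k ≤ m) : insertKnot t m z k = t k := if_pos h

theorem insertKnot_self : insertKnot t m z (m + 1) = z := by
  simp [insertKnot]

theorem insertKnot_succ_of_lt (h : m < k) : insertKnot t m z (k + 1) = t k := by
  rw [insertKnot, if_neg (by omega), if_neg (by omega), Nat.add_sub_cancel]

theorem insertKnot_monotone (ht : Monotone t) (hz : z ∈ Set.Ico (t m) (t (m + 1))) :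
    Monotone (insertKnot t m z) := by
  refine monotone_nat_of_le_succ fun k => ?_
  rcases lt_trichotomy k (m + 1) with h | rfl | h
  · rcases (Nat.lt_succ_iff.1 h).eq_or_lt with rfl | h
    · rw [insertKnot_of_le le_rfl, insertKnot_self]
      exact hz.1
    · rw [insertKnot_of_le h.le, insertKnot_of_le h]
      exact ht k.le_succ
  · rw [insertKnot_self, insertKnot_succ_of_lt m.lt_succ_self]
    exact hz.2.le
  · obtain ⟨k, rfl⟩ := Nat.exists_eq_succ_of_ne_zero (Nat.ne_zero_of_lt h)
    rw [insertKnot_succ_of_lt (Nat.succ_lt_succ_iff.1 h), insertKnot_succ_of_lt (by omega)]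
    exact ht k.le_succ

theorem insertCoeff_of_add_le (h : i + q ≤ m) : insertCoeff t m z q i = 1 := if_pos h

theorem insertCoeff_of_le_of_lt (hi : i ≤ m) (hq : m < i + q) :
    insertCoeff t m z q i = knotRatio t q i z := by
  rw [insertCoeff, if_neg hq.not_ge, if_pos hi]

theorem insertCoeff_of_lt (h : m < i) : insertCoeff t m z q i = 0 := by
  rw [insertCoeff, if_neg (by omega), if_neg h.not_ge]

theorem insertCoeff_nonneg (ht : Monotone t) (hz : t m ≤ z) : 0 ≤ insertCoeff t m z q i := by
  rw [insertCoeff]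
  split_ifs with _ hi
  · exact zero_le_one
  · exact div_nonneg (sub_nonneg.2 ((ht hi).trans hz)) (sub_nonneg.2 (ht (by omega)))
  · exact le_rfl

theorem insertCoeff_le_one (ht : Monotone t) (hz : z < t (m + 1)) :
    insertCoeff t m z q i ≤ 1 := by
  rw [insertCoeff]
  split_ifs with hq
  · exact le_rfl
  · have hlast : z ≤ t (i + q) := hz.le.trans (ht (by omega))
    exact div_le_one_of_le₀ (sub_le_sub_right hlast _) (sub_nonneg.2 (ht (by omega)))
  · exact zero_le_one

theorem insertCoeff_pos (ht : Monotone t) (hz : z < t (m + 1)) (hi : t i < z) :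
    0 < insertCoeff t m z q i := by
  have him : i ≤ m := by
    by_contra! hmi
    exact (hi.trans hz).not_ge (ht hmi)
  rw [insertCoeff]
  split_ifs with hq
  · exact zero_lt_one
  · have hlast : z < t (i + q) := hz.trans_le (ht (by omega))
    exact div_pos (sub_pos.2 hi) (sub_pos.2 (hi.trans hlast))

theorem insertCoeff_lt_one (ht : Monotone t) (hz : t m ≤ z) (hi : z < t (i + q)) :
    insertCoeff t m z q i < 1 := by
  have hq : ¬ i + q ≤ m := fun hle => ((ht hle).trans hz).not_gt hi
  rw [insertCoeff, if_neg hq]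
  split_ifs with him
  · have hfirst : t i ≤ z := (ht him).trans hz
    exact (div_lt_one (sub_pos.2 (hfirst.trans_lt hi))).2 (sub_lt_sub_right hi _)
  · exact zero_lt_one

theorem knotRatio_mul_insertCoeff
    (hlt : insertKnot t m z i < insertKnot t m z (i + q + 1)) :
    knotRatio t (q + 1) i x * insertCoeff t m z q i =
      insertCoeff t m z (q + 1) i * knotRatio (insertKnot t m z) (q + 1) i x := by
  rcases lt_or_ge m i with hi | hi
  · rw [insertCoeff_of_lt hi, insertCoeff_of_lt hi, mul_zero, zero_mul]
  simp only [knotRatio, ← add_assoc]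
  rw [insertKnot_of_le hi] at hlt ⊢
  rcases lt_trichotomy (i + q) m with h | h | h
  · rw [insertCoeff_of_add_le h.le, insertCoeff_of_add_le h, insertKnot_of_le h]
    ring
  · rw [insertCoeff_of_add_le h.le, insertCoeff_of_le_of_lt hi (by omega), knotRatio, ← add_assoc,
      h, insertKnot_self]
    rw [h, insertKnot_self] at hlt
    have hzi : z - t i ≠ 0 := (sub_pos.2 hlt).ne'
    field_simp
  · rw [insertCoeff_of_le_of_lt hi h, insertCoeff_of_le_of_lt hi (by omega),
      insertKnot_succ_of_lt h, knotRatio, knotRatio, ← add_assoc]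
    ring

theorem one_sub_knotRatio_mul_one_sub_insertCoeff (ht : Monotone t) (hz : t m ≤ z)
    (hlt : insertKnot t m z (i + 1) < insertKnot t m z (i + q + 2)) :
    (1 - knotRatio t (q + 1) i x) * (1 - insertCoeff t m z q (i + 1)) =
      (1 - insertCoeff t m z (q + 1) i) *
        (1 - knotRatio (insertKnot t m z) (q + 1) (i + 1) x) := by
  have e₁ : i + 1 + q = i + q + 1 := by omega
  have e₂ : i + 1 + (q + 1) = i + q + 1 + 1 := by omega
  rcases le_or_gt (i + q + 1) m with hq | hq
  · rw [insertCoeff_of_add_le (q := q) (by omega), insertCoeff_of_add_le (q := q + 1) hq]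
    ring
  simp only [knotRatio, e₂, ← add_assoc]
  rw [insertKnot_succ_of_lt hq] at hlt ⊢
  rcases lt_trichotomy i m with h | rfl | h
  · rw [insertKnot_of_le h] at hlt ⊢
    rw [insertCoeff_of_le_of_lt h (by omega), insertCoeff_of_le_of_lt h.le (by omega), knotRatio,
      knotRatio, e₁, ← add_assoc]
    have hi : t (i + q + 1) - t i ≠ 0 := (sub_pos.2 ((ht i.le_succ).trans_lt hlt)).ne'
    have hi' : t (i + q + 1) - t (i + 1) ≠ 0 := (sub_pos.2 hlt).ne'
    field_simp
    ring
  · rw [insertKnot_self] at hlt ⊢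
    rw [insertCoeff_of_lt (by omega), insertCoeff_of_le_of_lt le_rfl (by omega), knotRatio,
      ← add_assoc]
    have hi : t (i + q + 1) - t i ≠ 0 := (sub_pos.2 (hz.trans_lt hlt)).ne'
    have hiz : t (i + q + 1) - z ≠ 0 := (sub_pos.2 hlt).ne'
    field_simp
    ring
  · rw [insertKnot_succ_of_lt h, insertCoeff_of_lt (by omega), insertCoeff_of_lt h]
    ring

theorem coxDeBoor_zero_eq_insertKnot (hz : z ∈ Set.Ico (t m) (t (m + 1))) : coxDeBoor t 0 i x =
    insertCoeff t m z 0 i * coxDeBoor (insertKnot t m z) 0 i x +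
      (1 - insertCoeff t m z 0 (i + 1)) * coxDeBoor (insertKnot t m z) 0 (i + 1) x := by
  rcases lt_trichotomy i m with h | rfl | h
  · rw [insertCoeff_of_add_le (by omega), insertCoeff_of_add_le (by omega), sub_self, zero_mul,
      add_zero, one_mul]
    exact coxDeBoor_congr fun k hk => (insertKnot_of_le (by omega)).symm
  · rw [insertCoeff_of_add_le (by omega), insertCoeff_of_lt (by omega)]
    simp only [coxDeBoor, insertKnot_self, insertKnot_of_le le_rfl,
      insertKnot_succ_of_lt i.lt_succ_self]
    grind
  · rw [insertCoeff_of_lt h, insertCoeff_of_lt (by omega)]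
    simp only [coxDeBoor, insertKnot_succ_of_lt h, insertKnot_succ_of_lt (Nat.lt_succ_of_lt h),
      zero_mul, zero_add, sub_zero, one_mul]

/-- Boehm's knot insertion formula. In the induction, the coefficients of the two outer refined
B-splines are compared by `left` and `right`; since the weights in the recursion sum up to `1`, so
are those of the middle one. -/
theorem coxDeBoor_eq_insertKnot (ht : Monotone t) (hz : z ∈ Set.Ico (t m) (t (m + 1))) :
    coxDeBoor t q i x = insertCoeff t m z q i * coxDeBoor (insertKnot t m z) q i x +
      (1 - insertCoeff t m z q (i + 1)) * coxDeBoor (insertKnot t m z) q (i + 1) x := by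
  induction q generalizing i with
  | zero => exact coxDeBoor_zero_eq_insertKnot hz
  | succ q ih =>
    have ht' := insertKnot_monotone ht hz
    have left (j : ℕ) : (knotRatio t (q + 1) j x * insertCoeff t m z q j) *
        coxDeBoor (insertKnot t m z) q j x =
          (insertCoeff t m z (q + 1) j * knotRatio (insertKnot t m z) (q + 1) j x) *
            coxDeBoor (insertKnot t m z) q j x := by
      rcases lt_or_ge (insertKnot t m z j) (insertKnot t m z (j + q + 1)) with hlt | hle
      · rw [knotRatio_mul_insertCoeff hlt]
      · rw [coxDeBoor_eq_zero_of_knot_le ht' hle, mul_zero, mul_zero]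
    have right (j : ℕ) : ((1 - knotRatio t (q + 1) j x) * (1 - insertCoeff t m z q (j + 1))) *
        coxDeBoor (insertKnot t m z) q (j + 1) x =
          ((1 - insertCoeff t m z (q + 1) j) *
            (1 - knotRatio (insertKnot t m z) (q + 1) (j + 1) x)) *
              coxDeBoor (insertKnot t m z) q (j + 1) x := by
      rcases lt_or_ge (insertKnot t m z (j + 1)) (insertKnot t m z (j + q + 2)) with hlt | hle
      · rw [one_sub_knotRatio_mul_one_sub_insertCoeff ht hz.1 hlt]
      · rw [coxDeBoor_eq_zero_of_knot_le ht' (by rwa [show j + 1 + q + 1 = j + q + 2 by omega]),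
          mul_zero, mul_zero]
    rw [coxDeBoor_succ_eq_knotRatio ht, coxDeBoor_succ_eq_knotRatio ht',
      coxDeBoor_succ_eq_knotRatio ht', ih, ih]
    linear_combination left i - left (i + 1) - right i + right (i + 1)

end KnotInsertion

section Permutation

variable {ι : Type*} [LinearOrder ι] [Finite ι] {f : ι → ι}

theorem exists_le_and_le_apply (hf : Function.Injective f) (i : ι) : ∃ k ≤ i, i ≤ f k := by
  by_contra! h
  have himage : f '' Set.Iic i ⊂ Set.Iic i :=
    (Set.image_subset_iff (t := Set.Iio i).2 h).trans_ssubset Set.Iio_ssubset_Iic_self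
  exact (Set.ncard_lt_ncard himage).ne (Set.ncard_image_of_injective _ hf)

theorem exists_ge_and_apply_le (hf : Function.Injective f) (i : ι) : ∃ k ≥ i, f k ≤ i :=
  exists_le_and_le_apply (ι := ιᵒᵈ) hf i

theorem inSupport_of_injective {t : ℕ → ℝ} (ht : Monotone t) {q : ℕ} {x : ι → ℝ}
    (hx : Monotone x) {J : ι → ℕ} (hJ : Monotone J) (hf : Function.Injective f)
    (h : ∀ i, InSupport t q (J (f i)) (x i)) (i : ι) : InSupport t q (J i) (x i) := by
  obtain ⟨k, hki, hik⟩ := exists_le_and_le_apply hf i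
  obtain ⟨l, hil, hli⟩ := exists_ge_and_apply_le hf i
  exact ⟨(h k).1.mono ht (hJ hik) (hx hki), (h l).2.mono ht (hJ hli) (hx hil)⟩

end Permutation

section Determinant

variable {ι κ R : Type*} [Fintype ι] [DecidableEq ι] [Fintype κ] [CommRing R]

theorem exists_perm_of_det_ne_zero {A : Matrix ι ι R} (h : A.det ≠ 0) :
    ∃ σ : Equiv.Perm ι, ∀ i, A i (σ i) ≠ 0 := by
  rw [← Matrix.det_transpose, Matrix.det_apply] at h
  obtain ⟨σ, -, hσ⟩ := Finset.exists_ne_zero_of_sum_ne_zero h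
  exact ⟨σ, fun i hi => hσ (by rw [Finset.prod_eq_zero (Finset.mem_univ i) hi, smul_zero])⟩

theorem det_of_sum_mul (c : ι → κ → R) (v : ι → κ → ι → R) :
    (Matrix.of fun i j => ∑ e, c j e * v j e i).det =
      ∑ ε : ι → κ, (∏ j, c j (ε j)) * (Matrix.of fun i j => v j (ε j) i).det := by
  have hrows : (Matrix.of fun i j => ∑ e, c j e * v j e i).transpose =
      fun j => ∑ e, c j e • v j e := by
    ext j i
    simp [Finset.sum_apply]
  rw [← Matrix.det_transpose, hrows]
  refine (Matrix.detRowAlternating.toMultilinearMap.map_sum fun j e => c j e • v j e).trans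
    (Finset.sum_congr rfl fun ε _ => ?_)
  rw [← Matrix.det_transpose]
  exact MultilinearMap.map_smul_univ _ _ _

end Determinant

section Minors

/-- The collocation matrix of the B-splines of degree `q` with the indices `J` at the points `x`. -/
noncomputable def splineMatrix {ι : Type*} (t : ℕ → ℝ) (q : ℕ) (J : ι → ℕ) (x : ι → ℝ) :
    Matrix ι ι ℝ :=
  collocationMatrix (fun j => coxDeBoor t q (J j)) x

/-- The weights with which the two refined B-splines enter a B-spline in Boehm's formula. -/
noncomputable def insertWeight (t : ℕ → ℝ) (m : ℕ) (z : ℝ) (q j : ℕ) : Fin 2 → ℝ :=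
  ![insertCoeff t m z q j, 1 - insertCoeff t m z q (j + 1)]

/-- The conclusion of the Schoenberg–Whitney theorem for the points `x`: every collocation matrix of
B-splines at these points is of positive determinant if its diagonal is positive. -/
def MinorsPositive {ι : Type*} [Fintype ι] [LinearOrder ι] (t : ℕ → ℝ) (q : ℕ) (x : ι → ℝ) :
    Prop :=
  ∀ ⦃J : ι → ℕ⦄, StrictMono J → (∀ i, 0 < coxDeBoor t q (J i) (x i)) →
    0 < (splineMatrix t q J x).det

variable {ι : Type*} [Fintype ι] {t : ℕ → ℝ} {m q j : ℕ} {y z : ℝ} {J : ι → ℕ} {x : ι → ℝ}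

theorem insertWeight_nonneg (ht : Monotone t) (hz : z ∈ Set.Ico (t m) (t (m + 1))) (e : Fin 2) :
    0 ≤ insertWeight t m z q j e := by
  fin_cases e
  · exact insertCoeff_nonneg ht hz.1
  · exact sub_nonneg.2 (insertCoeff_le_one ht hz.2)

theorem coxDeBoor_eq_sum_insertKnot (ht : Monotone t) (hz : z ∈ Set.Ico (t m) (t (m + 1))) :
    coxDeBoor t q j y =
      ∑ e : Fin 2, insertWeight t m z q j e * coxDeBoor (insertKnot t m z) q (j + e) y := by
  rw [Fin.sum_univ_two]
  exact coxDeBoor_eq_insertKnot ht hz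

theorem inSupport_insertKnot_of_lt (ht : Monotone t) (hz : z ∈ Set.Ico (t m) (t (m + 1)))
    (hy : y < z) (h : InSupport t q j y) : InSupport (insertKnot t m z) q j y := by
  have knot_gt {k : ℕ} (hk : m < k) : y < t k := (hy.trans hz.2).trans_le (ht hk)
  have refined_gt {k : ℕ} (hk : m < k) : y < insertKnot t m z k :=
    (hy.trans_eq insertKnot_self.symm).trans_le (insertKnot_monotone ht hz hk)
  refine (inSupport_congr (fun k => ?_) fun k => ?_).1 h <;> rcases le_or_gt (j + k) m with hk | hk
  · rw [insertKnot_of_le hk]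
  · exact iff_of_false (knot_gt hk).not_gt (refined_gt hk).not_gt
  · rw [insertKnot_of_le hk]
  · exact iff_of_true (knot_gt hk) (refined_gt hk)

theorem inSupport_insertKnot_of_gt (ht : Monotone t) (hz : z ∈ Set.Ico (t m) (t (m + 1)))
    (hy : z < y) (h : InSupport t q j y) : InSupport (insertKnot t m z) q (j + 1) y := by
  have knot_lt {k : ℕ} (hk : k ≤ m) : t k < y := ((ht hk).trans hz.1).trans_lt hy
  have refined_lt {k : ℕ} (hk : k ≤ m) : insertKnot t m z (k + 1) < y :=
    (insertKnot_monotone ht hz (Nat.succ_le_succ hk)).trans_lt (insertKnot_self.trans_lt hy)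
  refine (inSupport_congr (fun k => ?_) fun k => ?_).1 h <;> rw [add_right_comm] <;>
    rcases lt_or_ge m (j + k) with hk | hk
  · rw [insertKnot_succ_of_lt hk]
  · exact iff_of_true (knot_lt hk) (refined_lt hk)
  · rw [insertKnot_succ_of_lt hk]
  · exact iff_of_false (knot_lt hk).not_gt (refined_lt hk).not_gt

theorem exists_insertWeight_pos_and_coxDeBoor_insertKnot_pos (ht : Monotone t)
    (hz : z ∈ Set.Ico (t m) (t (m + 1))) (h : 0 < coxDeBoor t q j y) :
    ∃ e : Fin 2, (y < z → e = 0) ∧ (z < y → e = 1) ∧ 0 < insertWeight t m z q j e ∧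
      0 < coxDeBoor (insertKnot t m z) q (j + e) y := by
  have ht' := insertKnot_monotone ht hz
  have hsupp := (coxDeBoor_pos_iff ht).1 h
  rcases lt_trichotomy y z with hy | hy | hy
  · exact ⟨0, fun _ => rfl, fun hy' => absurd hy' hy.not_gt,
      insertCoeff_pos ht hz.2 (hsupp.knot_le.trans_lt hy),
      coxDeBoor_pos ht' (inSupport_insertKnot_of_lt ht hz hy hsupp)⟩
  · rw [coxDeBoor_eq_sum_insertKnot ht hz] at h
    obtain ⟨e, -, he⟩ := Finset.exists_ne_zero_of_sum_ne_zero h.ne'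
    exact ⟨e, fun hy' => absurd hy hy'.ne, fun hy' => absurd hy hy'.ne',
      (insertWeight_nonneg ht hz e).lt_of_ne' (left_ne_zero_of_mul he),
      (coxDeBoor_nonneg ht').lt_of_ne' (right_ne_zero_of_mul he)⟩
  · have hend : z < t (j + 1 + q) := by
      rw [add_right_comm]
      exact hy.trans_le hsupp.le_knot
    exact ⟨1, fun hy' => absurd hy' hy.not_gt, fun _ => rfl,
      sub_pos.2 (insertCoeff_lt_one ht hz.1 hend),
      coxDeBoor_pos ht' (inSupport_insertKnot_of_gt ht hz hy hsupp)⟩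

theorem det_splineMatrix_eq_sum [DecidableEq ι] (ht : Monotone t)
    (hz : z ∈ Set.Ico (t m) (t (m + 1))) :
    (splineMatrix t q J x).det = ∑ ε : ι → Fin 2, (∏ j, insertWeight t m z q (J j) (ε j)) *
      (splineMatrix (insertKnot t m z) q (fun j => J j + (ε j : ℕ)) x).det := by
  simp only [splineMatrix, collocationMatrix, coxDeBoor_eq_sum_insertKnot ht hz]
  exact det_of_sum_mul _ fun j (e : Fin 2) i => coxDeBoor (insertKnot t m z) q (J j + e) (x i)

variable [LinearOrder ι]

theorem coxDeBoor_pos_of_det_splineMatrix_ne_zero (ht : Monotone t) (hx : Monotone x)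
    (hJ : Monotone J) (h : (splineMatrix t q J x).det ≠ 0) (i : ι) :
    0 < coxDeBoor t q (J i) (x i) := by
  obtain ⟨σ, hσ⟩ := exists_perm_of_det_ne_zero h
  exact coxDeBoor_pos ht (inSupport_of_injective ht hx hJ σ.injective
    (fun i => (coxDeBoor_ne_zero_iff ht).1 (hσ i)) i)

theorem MinorsPositive.det_nonneg (h : MinorsPositive t q x) (ht : Monotone t) (hx : Monotone x)
    (hJ : Monotone J) : 0 ≤ (splineMatrix t q J x).det := by
  by_cases hdet : (splineMatrix t q J x).det = 0
  · exact hdet.ge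
  have hinj : Function.Injective J := fun i j hij => by
    by_contra hne
    exact hdet (Matrix.det_zero_of_column_eq hne fun k => by
      simp only [splineMatrix, collocationMatrix, Matrix.of_apply, hij])
  exact (h (hJ.strictMono_of_injective hinj)
    (coxDeBoor_pos_of_det_splineMatrix_ne_zero ht hx hJ hdet)).le

theorem MinorsPositive.of_insertKnot (ht : Monotone t) (hz : z ∈ Set.Ico (t m) (t (m + 1)))
    (hx : StrictMono x) (h : MinorsPositive (insertKnot t m z) q x) : MinorsPositive t q x := by
  intro J hJ hpos
  have index_mono (ε : ι → Fin 2) : Monotone fun i => J i + (ε i : ℕ) :=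
    monotone_iff_forall_lt.2 fun i j hij => by
      have := hJ hij
      omega
  have term_nonneg (ε : ι → Fin 2) : 0 ≤ (∏ j, insertWeight t m z q (J j) (ε j)) *
      (splineMatrix (insertKnot t m z) q (fun j => J j + ε j) x).det :=
    mul_nonneg (Finset.prod_nonneg fun j _ => insertWeight_nonneg ht hz (ε j))
      (h.det_nonneg (insertKnot_monotone ht hz) hx.monotone (index_mono ε))
  choose ε hleft hright hweight hdiag using fun i =>
    exists_insertWeight_pos_and_coxDeBoor_insertKnot_pos ht hz (hpos i)
  have hε : Monotone ε := monotone_iff_forall_lt.2 fun i j hij => by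
    rcases lt_or_ge (x i) z with hi | hi
    · exact (hleft i hi).trans_le (Fin.zero_le _)
    · exact (Fin.le_last _).trans_eq (hright j (hi.trans_lt (hx hij))).symm
  rw [det_splineMatrix_eq_sum ht hz]
  exact Finset.sum_pos' (fun ε _ => term_nonneg ε) ⟨ε, Finset.mem_univ ε,
    mul_pos (Finset.prod_pos fun j _ => hweight j)
      (h (hJ.add_monotone (Fin.val_strictMono.monotone.comp hε)) hdiag)⟩

end Minors

section SchoenbergWhitney

/-- The value `y` occurs at least `r` times in a row among the knots `t`. -/
def HasMultiplicity (t : ℕ → ℝ) (r : ℕ) (y : ℝ) : Prop := ∃ k, ∀ l < r, t (k + l) = y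

/-- The knots `t` up to the one with index `N`, followed by knots which tend to infinity. -/
def extendKnots (t : ℕ → ℝ) (N k : ℕ) : ℝ := t (min k N) + (k - N : ℕ)

variable {t : ℕ → ℝ} {m q r i j k N : ℕ} {y z : ℝ}

theorem HasMultiplicity.insert (h : HasMultiplicity t r y) (ht : Monotone t)
    (hz : z ∈ Set.Ico (t m) (t (m + 1))) : HasMultiplicity (insertKnot t m z) r y := by
  obtain ⟨k, hk⟩ := h
  rcases le_or_gt y z with hyz | hzy
  · refine ⟨k, fun l hl => ?_⟩
    have hlm : k + l ≤ m := by
      by_contra! hml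
      exact (hyz.trans_lt hz.2).not_ge ((ht hml).trans_eq (hk l hl))
    rw [insertKnot_of_le hlm, hk l hl]
  · refine ⟨k + 1, fun l hl => ?_⟩
    have hml : m < k + l := by
      by_contra! hlm
      exact (hz.1.trans_lt hzy).not_ge ((hk l hl).symm.trans_le (ht hlm))
    rw [add_right_comm, insertKnot_succ_of_lt hml, hk l hl]

theorem HasMultiplicity.insert_self (h : HasMultiplicity t r z) (ht : Monotone t)
    (hz : z ∈ Set.Ico (t m) (t (m + 1))) : HasMultiplicity (insertKnot t m z) (r + 1) z := by
  obtain ⟨k, hk⟩ := h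
  rcases r with _ | r
  · exact ⟨m + 1, fun l hl => by rw [Nat.lt_one_iff.1 hl, add_zero, insertKnot_self]⟩
  have hkm : k + r ≤ m := by
    by_contra! hmk
    exact hz.2.not_ge ((ht hmk).trans_eq (hk r r.lt_succ_self))
  have hfirst : insertKnot t m z k = z := by
    rw [insertKnot_of_le (by omega)]
    exact hk 0 r.succ_pos
  have hmono := insertKnot_monotone ht hz
  exact ⟨k, fun l hl => le_antisymm
    ((hmono (show k + l ≤ m + 1 by omega)).trans_eq insertKnot_self)
    (hfirst.symm.trans_le (hmono (k.le_add_right l)))⟩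

theorem InSupport.index_eq (ht : Monotone t) (hmult : HasMultiplicity t (q + 1) y)
    (hi : InSupport t q i y) (hj : InSupport t q j y) : i = j := by
  obtain ⟨k, hk⟩ := hmult
  have not_index_lt {i j : ℕ} (hi : InSupport t q i y) (hj : InSupport t q j y) : ¬ i < j := by
    intro hij
    have hfirst : t k = y := hk 0 (by omega)
    have hlast : t (k + q) = y := hk q (by omega)
    by_cases hleft : LeftOf y y
    · have hki : k ≤ i := by
        by_contra! hik
        exact hi.2.1 (hleft.mono (hlast ▸ ht (by omega)) le_rfl)
      have hyj : y ≤ t j := hfirst ▸ ht (show k ≤ j by omega)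
      have hend : LeftOf (t (j + q)) y := hj.1.2.resolve_left hyj.not_gt
      exact hi.2.1 (hend.mono (ht (by omega)) le_rfl)
    · have hjk : j < k := by
        by_contra! hkj
        exact hleft (hj.1.1.mono (hfirst ▸ ht hkj) le_rfl)
      have hiy : t (i + q + 1) ≤ y := hlast ▸ ht (show i + q + 1 ≤ k + q by omega)
      have hstart : ¬ LeftOf (t (i + 1)) y := hi.2.2.resolve_left hiy.not_gt
      exact hstart (hj.1.1.mono (ht hij) le_rfl)
  exact le_antisymm (not_lt.1 (not_index_lt hj hi)) (not_lt.1 (not_index_lt hi hj))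

theorem exists_mem_Ico_knot (h : t 0 ≤ z) (htop : Filter.Tendsto t Filter.atTop Filter.atTop) :
    ∃ m, z ∈ Set.Ico (t m) (t (m + 1)) := by
  by_contra! hno
  have hle (k : ℕ) : t k ≤ z := by
    induction k with
    | zero => exact h
    | succ k ih => exact not_lt.1 fun hlt => hno k ⟨ih, hlt⟩
  obtain ⟨k, hk⟩ := (htop.eventually_gt_atTop z).exists
  exact hk.not_ge (hle k)

theorem tendsto_insertKnot (htop : Filter.Tendsto t Filter.atTop Filter.atTop) :
    Filter.Tendsto (insertKnot t m z) Filter.atTop Filter.atTop := by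
  rw [← Filter.tendsto_add_atTop_iff_nat 1]
  refine htop.congr' ?_
  filter_upwards [Filter.eventually_gt_atTop m] with k hk
  exact (insertKnot_succ_of_lt hk).symm

theorem insertKnot_induction {P : (ℕ → ℝ) → Prop} {S : Finset ℝ}
    (insert : ∀ t m z, Monotone t → z ∈ Set.Ico (t m) (t (m + 1)) → P (insertKnot t m z) → P t)
    (full : ∀ t, Monotone t → (∀ y ∈ S, HasMultiplicity t r y) → P t)
    (ht : Monotone t) (htop : Filter.Tendsto t Filter.atTop Filter.atTop)
    (hS : ∀ y ∈ S, t 0 ≤ y) : P t := by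
  -- `M` is the multiset of the knots which are still to be inserted.
  suffices H : ∀ M : Multiset ℝ, ∀ t, Monotone t → Filter.Tendsto t Filter.atTop Filter.atTop →
      (∀ y ∈ M, t 0 ≤ y) → (∀ y ∈ S, HasMultiplicity t (r - M.count y) y) → P t by
    refine H (r • S.val) t ht htop (fun y hy => hS y (Multiset.mem_of_mem_nsmul hy))
      fun y hy => ⟨0, fun l hl => ?_⟩
    rw [Multiset.count_nsmul, Multiset.count_eq_one_of_mem S.nodup hy] at hl
    omega
  intro M
  induction M using Multiset.induction_on with
  | empty => exact fun t ht _ _ hmult => full t ht hmult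
  | cons z M ih =>
    intro t ht htop hM hmult
    obtain ⟨m, hz⟩ := exists_mem_Ico_knot (hM z (Multiset.mem_cons_self z M)) htop
    refine insert t m z ht hz (ih _ (insertKnot_monotone ht hz) (tendsto_insertKnot htop) ?_ ?_)
    · intro y hy
      rw [insertKnot_of_le m.zero_le]
      exact hM y (Multiset.mem_cons_of_mem hy)
    · intro y hy
      rcases eq_or_ne y z with rfl | hne
      · obtain ⟨k, hk⟩ := (hmult y hy).insert_self ht hz
        rw [Multiset.count_cons_self] at hk
        exact ⟨k, fun l hl => hk l (by omega)⟩
      · rw [← Multiset.count_cons_of_ne hne M]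
        exact (hmult y hy).insert ht hz

theorem extendKnots_of_le (h : k ≤ N) : extendKnots t N k = t k := by
  simp [extendKnots, h]

theorem extendKnots_monotone (ht : Monotone t) : Monotone (extendKnots t N) := fun _ _ h =>
  add_le_add (ht (min_le_min_right N h)) (Nat.cast_le.2 (Nat.sub_le_sub_right h N))

theorem tendsto_extendKnots : Filter.Tendsto (extendKnots t N) Filter.atTop Filter.atTop := by
  rw [← Filter.tendsto_add_atTop_iff_nat N]
  simpa [extendKnots] using Filter.tendsto_atTop_add_const_left _ (t N)
    tendsto_natCast_atTop_atTop

variable {ι : Type*} [Fintype ι] [LinearOrder ι] {J : ι → ℕ} {x : ι → ℝ}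

theorem MinorsPositive.of_hasMultiplicity (ht : Monotone t)
    (hmult : ∀ i, HasMultiplicity t (q + 1) (x i)) : MinorsPositive t q x := by
  intro J hJ hpos
  have hdiag : splineMatrix t q J x = Matrix.diagonal fun i => coxDeBoor t q (J i) (x i) := by
    ext i j
    rcases eq_or_ne i j with rfl | hne
    · exact (Matrix.diagonal_apply_eq _ i).symm
    · rw [Matrix.diagonal_apply_ne _ hne]
      have hi : InSupport t q (J i) (x i) := (coxDeBoor_pos_iff ht).1 (hpos i)
      exact coxDeBoor_eq_zero ht fun hj => hne (hJ.injective (hi.index_eq ht (hmult i) hj))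
  rw [hdiag, Matrix.det_diagonal]
  exact Finset.prod_pos fun i _ => hpos i

theorem det_splineMatrix_pos (ht : Monotone t) (hx : StrictMono x) (hJ : StrictMono J)
    (hpos : ∀ i, 0 < coxDeBoor t q (J i) (x i)) : 0 < (splineMatrix t q J x).det := by
  let u := extendKnots t (Finset.univ.sup J + q + 1)
  have hu : Monotone u := extendKnots_monotone ht
  have heq (i : ι) : coxDeBoor t q (J i) = coxDeBoor u q (J i) := by
    have hJi : J i ≤ Finset.univ.sup J := Finset.le_sup (Finset.mem_univ i)
    exact funext fun y => coxDeBoor_congr fun k hk => (extendKnots_of_le (by omega)).symm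
  have hmatrix : splineMatrix t q J x = splineMatrix u q J x := by
    simp only [splineMatrix, heq]
  simp only [heq] at hpos
  have hu0 : ∀ y ∈ Finset.univ.image x, u 0 ≤ y := by
    simp only [Finset.forall_mem_image]
    exact fun i _ => (hu (Nat.zero_le _)).trans ((coxDeBoor_pos_iff hu).1 (hpos i)).knot_le
  have hminors : MinorsPositive u q x :=
    insertKnot_induction (P := fun t => MinorsPositive t q x) (r := q + 1)
      (fun _ _ _ ht hz => MinorsPositive.of_insertKnot ht hz hx)
      (fun _ ht hmult => .of_hasMultiplicity ht fun i =>
        hmult _ (Finset.mem_image_of_mem x (Finset.mem_univ i)))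
      hu tendsto_extendKnots hu0
  exact hmatrix ▸ hminors hJ hpos

end SchoenbergWhitney

section Univariate

variable {p n : ℕ} {ξ : Fin n → ℝ}

theorem KnotVector.dim_pos (Ξ : KnotVector p n) : 0 < n := by
  by_contra! hn
  have hle : Ξ.knot ⟨n, by omega⟩ ≤ Ξ.knot ⟨p, by omega⟩ :=
    Ξ.monotone_knot (Fin.mk_le_mk.2 (by omega))
  rw [Ξ.knot_left, Ξ.knot_right] at hle
  exact hle.not_gt one_pos

theorem KnotVector.seq_monotone (Ξ : KnotVector p n) : Monotone Ξ.seq := fun _ _ h =>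
  Ξ.monotone_knot (Fin.mk_le_mk.2 (min_le_min_right _ h))

theorem KnotVector.bspline_nonneg (Ξ : KnotVector p n) (j : Fin n) (x : ℝ) : 0 ≤ Ξ.bspline j x :=
  coxDeBoor_nonneg Ξ.seq_monotone

theorem KnotVector.isUnit_collocationMatrix (Ξ : KnotVector p n) (hinj : Function.Injective ξ)
    (hpos : ∀ j, 0 < Ξ.bspline j (ξ j)) : IsUnit (collocationMatrix Ξ.bspline ξ) := by
  let σ := Tuple.sort ξ
  have hmono : Monotone (ξ ∘ σ) := Tuple.monotone_sort ξ
  have hsorted (i : Fin n) : InSupport Ξ.seq p i ((ξ ∘ σ) i) :=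
    inSupport_of_injective Ξ.seq_monotone hmono Fin.val_strictMono.monotone σ.injective
      (fun i => (coxDeBoor_pos_iff Ξ.seq_monotone).1 (hpos (σ i))) i
  have hdet : 0 < (splineMatrix Ξ.seq p Fin.val (ξ ∘ σ)).det :=
    det_splineMatrix_pos Ξ.seq_monotone (hmono.strictMono_of_injective (hinj.comp σ.injective))
      Fin.val_strictMono fun i => coxDeBoor_pos Ξ.seq_monotone (hsorted i)
  have hsubmatrix : splineMatrix Ξ.seq p Fin.val (ξ ∘ σ) =
      (collocationMatrix Ξ.bspline ξ).submatrix σ (Equiv.refl _) := rfl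
  rw [← Matrix.isUnit_submatrix_equiv σ (Equiv.refl _), ← hsubmatrix]
  exact (Matrix.isUnit_iff_isUnit_det _).2 hdet.ne'.isUnit

theorem KnotVector.bspline_pos_of_isUnit (Ξ : KnotVector p n) (hmono : Monotone ξ)
    (h : IsUnit (collocationMatrix Ξ.bspline ξ)) (j : Fin n) : 0 < Ξ.bspline j (ξ j) :=
  coxDeBoor_pos_of_det_splineMatrix_ne_zero Ξ.seq_monotone hmono Fin.val_strictMono.monotone
    ((Matrix.isUnit_iff_isUnit_det _).1 h).ne_zero j

end Univariate

section TensorProduct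

/-- The tensor product (Kronecker product) of a finite family of matrices. -/
def tensorMatrix {κ R : Type*} [Fintype κ] [CommSemiring R] {ι : κ → Type*}
    (A : ∀ k, Matrix (ι k) (ι k) R) : Matrix (∀ k, ι k) (∀ k, ι k) R :=
  Matrix.of fun i j => ∏ k, A k (i k) (j k)

variable {κ R : Type*} [Fintype κ] {ι : κ → Type*}

theorem tensorMatrix_one [CommSemiring R] [∀ k, DecidableEq (ι k)] :
    tensorMatrix (fun k => (1 : Matrix (ι k) (ι k) R)) = 1 := by
  classical
  ext i j
  simp only [tensorMatrix, Matrix.of_apply, Matrix.one_apply, Finset.prod_ite_zero,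
    Finset.prod_const_one, Finset.mem_univ, true_imp_iff, funext_iff]

variable [DecidableEq κ] [∀ k, Fintype (ι k)]

theorem tensorMatrix_mul [CommSemiring R] (A B : ∀ k, Matrix (ι k) (ι k) R) :
    tensorMatrix A * tensorMatrix B = tensorMatrix fun k => A k * B k := by
  ext i j
  simp only [tensorMatrix, Matrix.mul_apply, Matrix.of_apply, Finset.prod_univ_sum,
    Fintype.piFinset_univ, Finset.prod_mul_distrib]

theorem tensorMatrix_mulVec [CommSemiring R] (A : ∀ k, Matrix (ι k) (ι k) R) (v : ∀ k, ι k → R) :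
    (tensorMatrix A).mulVec (fun j => ∏ k, v k (j k)) =
      fun i => ∏ k, (A k).mulVec (v k) (i k) := by
  ext i
  simp only [tensorMatrix, Matrix.mulVec, dotProduct, Matrix.of_apply, Finset.prod_univ_sum,
    Fintype.piFinset_univ, Finset.prod_mul_distrib]

variable [∀ k, DecidableEq (ι k)]

theorem isUnit_tensorMatrix [CommSemiring R] {A : ∀ k, Matrix (ι k) (ι k) R}
    (h : ∀ k, IsUnit (A k)) : IsUnit (tensorMatrix A) := by
  choose B hAB hBA using fun k => isUnit_iff_exists.1 (h k)
  refine isUnit_iff_exists.2 ⟨tensorMatrix B, ?_, ?_⟩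
  · rw [tensorMatrix_mul, funext hAB, tensorMatrix_one]
  · rw [tensorMatrix_mul, funext hBA, tensorMatrix_one]

theorem isUnit_tensorMatrix_iff [Field R] [∀ k, Nonempty (ι k)]
    {A : ∀ k, Matrix (ι k) (ι k) R} : IsUnit (tensorMatrix A) ↔ ∀ k, IsUnit (A k) := by
  refine ⟨fun h k => ?_, isUnit_tensorMatrix⟩
  rw [Matrix.isUnit_iff_isUnit_det, isUnit_iff_ne_zero] at h ⊢
  contrapose! h
  obtain ⟨v, hv, hAv⟩ := Matrix.exists_mulVec_eq_zero_iff.2 h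
  -- A vector in the kernel of `A k` is tensored with vectors of ones.
  let w : ∀ l, ι l → R := Function.update 1 k v
  have hwk : w k = v := Function.update_self ..
  have hw (l : κ) : ∃ b, w l b ≠ 0 := by
    rcases eq_or_ne l k with rfl | hl
    · exact hwk ▸ Function.ne_iff.1 hv
    · exact ⟨Classical.arbitrary _, by simp [w, Function.update_of_ne hl]⟩
  choose b hb using hw
  refine Matrix.exists_mulVec_eq_zero_iff.1 ⟨fun j => ∏ l, w l (j l), ?_, ?_⟩
  · exact Function.ne_iff.2 ⟨b, Finset.prod_ne_zero_iff.2 fun l _ => hb l⟩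
  · ext i
    rw [tensorMatrix_mulVec]
    exact Finset.prod_eq_zero (Finset.mem_univ k) (by rw [hwk, hAv, Pi.zero_apply])

end TensorProduct

section Interpolation

variable {d : ℕ} {p n : Fin d → ℕ} {Ξ : ∀ k, KnotVector (p k) (n k)}
  {F : (Fin d → ℝ) → (Fin d → ℝ)} {ξ : ∀ k, Fin (n k) → ℝ}

theorem physBasis_interpPoint (hF : Set.InjOn F (Set.Icc 0 1))
    (hξ : ∀ k j, ξ k j ∈ Set.Icc (0 : ℝ) 1) (i j : ∀ k, Fin (n k)) :
    physBasis Ξ F j (interpPoint F ξ i) = ∏ k, (Ξ k).bspline (j k) (ξ k (i k)) := by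
  have hmem : (fun k => ξ k (i k)) ∈ Set.Icc (0 : Fin d → ℝ) 1 :=
    ⟨fun k => (hξ k (i k)).1, fun k => (hξ k (i k)).2⟩
  rw [physBasis, interpPoint, hF.leftInvOn_invFunOn hmem, paramBasis]

theorem collocationMatrix_eq_tensorMatrix (hF : Set.InjOn F (Set.Icc 0 1))
    (hξ : ∀ k j, ξ k j ∈ Set.Icc (0 : ℝ) 1) :
    collocationMatrix (physBasis Ξ F) (interpPoint F ξ) =
      tensorMatrix fun k => collocationMatrix (Ξ k).bspline (ξ k) := by
  ext i j
  exact physBasis_interpPoint hF hξ i j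

theorem physBasis_interpPoint_pos_iff [∀ k, Nonempty (Fin (n k))]
    (hF : Set.InjOn F (Set.Icc 0 1)) (hξ : ∀ k j, ξ k j ∈ Set.Icc (0 : ℝ) 1) :
    (∀ i, 0 < physBasis Ξ F i (interpPoint F ξ i)) ↔ ∀ k j, 0 < (Ξ k).bspline j (ξ k j) := by
  simp only [physBasis_interpPoint hF hξ]
  refine ⟨fun h k j => ?_, fun h i => Finset.prod_pos fun k _ => h k (i k)⟩
  obtain ⟨i, rfl⟩ := Function.surjective_eval (β := fun k => Fin (n k)) k j
  exact ((Ξ k).bspline_nonneg _ _).lt_of_ne'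
    (Finset.prod_ne_zero_iff.1 (h i).ne' k (Finset.mem_univ k))

theorem injective_of_injective_interpPoint [∀ k, Nonempty (Fin (n k))]
    (h : Function.Injective (interpPoint F ξ)) (k : Fin d) : Function.Injective (ξ k) := by
  have hgrid : Function.Injective (Pi.map ξ) := h.of_comp (f := F)
  exact Pi.map_injective.1 hgrid k

end Interpolation

end TensorSpline

theorem theorem4p1 {d : ℕ} (p n : Fin d → ℕ)
    (Ξ : ∀ k, TensorSpline.KnotVector (p k) (n k))
    (F : (Fin d → ℝ) → (Fin d → ℝ)) (hF : Set.InjOn F (Set.Icc 0 1))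
    (ξ : ∀ k, Fin (n k) → ℝ) (hξ : ∀ k j, ξ k j ∈ Set.Icc (0 : ℝ) 1)
    (hdistinct : Function.Injective (TensorSpline.interpPoint F ξ)) :
    ((∀ i, 0 < TensorSpline.physBasis Ξ F i (TensorSpline.interpPoint F ξ i)) →
      IsUnit (TensorSpline.collocationMatrix (TensorSpline.physBasis Ξ F)
        (TensorSpline.interpPoint F ξ))) ∧
    ((∀ k, Monotone (ξ k)) →
      (IsUnit (TensorSpline.collocationMatrix (TensorSpline.physBasis Ξ F)
        (TensorSpline.interpPoint F ξ)) ↔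
      ∀ i, 0 < TensorSpline.physBasis Ξ F i (TensorSpline.interpPoint F ξ i))) := by
  have (k : Fin d) : Nonempty (Fin (n k)) := ⟨⟨0, (Ξ k).dim_pos⟩⟩
  rw [TensorSpline.collocationMatrix_eq_tensorMatrix hF hξ, TensorSpline.isUnit_tensorMatrix_iff,
    TensorSpline.physBasis_interpPoint_pos_iff hF hξ]
  have sufficient (hpos : ∀ k j, 0 < (Ξ k).bspline j (ξ k j)) (k : Fin d) :
      IsUnit (TensorSpline.collocationMatrix (Ξ k).bspline (ξ k)) :=
    (Ξ k).isUnit_collocationMatrix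
      (TensorSpline.injective_of_injective_interpPoint hdistinct k) (hpos k)
  exact ⟨sufficient, fun hmono =>
    ⟨fun hunit k => (Ξ k).bspline_pos_of_isUnit (hmono k) (hunit k), sufficient⟩⟩
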